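/- Let $n,m,T$ be positive integers, let $\mathbb X\subseteq\mathbb R^n$, and consider the discrete-time system with input saturation $$x^+=A(x)x+B(x)\,\mathrm{sat}(u),\qquad A(x)\in\mathbb R^{n\times n},\quad B(x)\in\mathbb R^{n\times m},\quad x\in\mathbb X,$$ where $\mathrm{sat}(u)_i=\mathrm{sign}(u_i)\min(|u_i|,\bar u_i)$ with given levels $\bar u_i>0$, $i=1,\dots,m$. Write $\preceq,\succeq,\succ$ for the semidefinite order on symmetric matrices, $\lambda_{\max},\lambda_{\min}$ for the extreme eigenvalues, $|\cdot|$ for the Euclidean norm, $\mathcal B_\rho=\{x\in\mathbb R^n:|x|\le\rho\}$, and $M_{(i)}$ for the $i$-th row of $M$. **Basis functions.** There are known functions $\xi_{A_j}:\mathbb R^n\to\mathbb R^{n_{A_j}}$ ($j=1,\dots,n$) and $\xi_{B_j}:\mathbb R^n\to\mathbb R^{n_{B_j}}$ ($j=1,\dots,m$), continuous on $\mathbb X$, and unknown constant matrices $E_{A_j}\in\mathbb R^{n\times n_{A_j}}$, $E_{B_j}\in\mathbb R^{n\times n_{B_j}}$ such that for all $x\in\mathbb X$ the $j$-th column of $A(x)$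 is $E_{A_j}\xi_{A_j}(x)$ and the $j$-th column of $B(x)$ is $E_{B_j}\xi_{B_j}(x)$. Put $E_A=[E_{A_1}\cdots E_{A_n}]$, $E_B=[E_{B_1}\cdots E_{B_m}]$, $n_A=\sum_j n_{A_j}$, $n_B=\sum_j n_{B_j}$, $\Xi_A(x)=\mathrm{blkdiag}(\xi_{A_1}(x),\dots,\xi_{A_n}(x))$ and $\Xi_B(x)=\mathrm{blkdiag}(\xi_{B_1}(x),\dots,\xi_{B_m}(x))$. **Data.** The data $x_d(0),\dots,x_d(T)\in\mathbb R^n$ and $u_d(0),\dots,u_d(T-1)\in\mathbb R^m$ satisfy, for $k=0,\dots,T-1$, $$x_d(k+1)=E_A\,\Xi_A(x_d(k))\,x_d(k)+E_B\,\Xi_B(x_d(k))\,u_d(k)+d(k)$$ with an unknown noise sequence for which $D_0=[d(0)\cdots d(T-1)]$ satisfies $D_0D_0^\top\preceq\Theta$, where $\Theta\succeq0$ is known. Let $$X_0=[\Xi_A(x_d(0))x_d(0)\ \cdots\ \Xi_A(x_d(T-1))x_d(T-1)],\quad X_1=[x_d(1)\ \cdots\ x_d(T)],$$ $$U_0=[\Xi_B(x_d(0))u_d(0)\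 \cdots\ \Xi_B(x_d(T-1))u_d(T-1)],$$ and assume that $\begin{bmatrix}X_0\\U_0\end{bmatrix}$ has full row rank. Put $$\mathbf A=\begin{bmatrix}X_0\\U_0\end{bmatrix}\begin{bmatrix}X_0\\U_0\end{bmatrix}^\top,\qquad \mathbf B=-X_1\begin{bmatrix}X_0\\U_0\end{bmatrix}^\top,\qquad \mathbf C=X_1X_1^\top-\Theta .$$ **Vertices.** Let $r>0$ with $\mathcal B_r\subseteq\mathbb X$. Let $\bar{\mathcal Q}$ be the finite set of all matrices $\mathrm{blkdiag}(\zeta_{A_1},\dots,\zeta_{A_n},\zeta_{B_1},\dots,\zeta_{B_m})\in\mathbb R^{(n_A+n_B)\times(n+m)}$, with $\zeta_{A_j}\in\mathbb R^{n_{A_j}}$ and $\zeta_{B_j}\in\mathbb R^{n_{B_j}}$, in which every entry of every $\zeta_{A_j}$, $\zeta_{B_j}$ equals either the maximum or the minimum over $\mathcal B_r$ of the corresponding entry of $\xi_{A_j}$, $\xi_{B_j}$. **Theorem.** Suppose that there are $\bar\Gamma\in\mathbb R^{n\times n}$ with $\bar\Gamma\succ0$, $\epsilon_{\bar\Gamma}>0$,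 $\bar Y,\bar W\in\mathbb R^{m\times n}$ and a diagonal positive definite $\bar S\in\mathbb R^{m\times m}$ such that $$\begin{bmatrix}\bar\Gamma&\bar W_{(i)}^\top\\ \bar W_{(i)}&\bar u_i^2\end{bmatrix}\succeq0,\qquad i=1,\dots,m,$$ $$\begin{bmatrix}-\bar\Gamma+\epsilon_{\bar\Gamma}I_n&-\bar Y^\top-\bar W^\top&0&\begin{bmatrix}\bar\Gamma\\ \bar Y\end{bmatrix}^\top Q^\top\\ -\bar Y-\bar W&-2\bar S&0&\begin{bmatrix}0\\ \bar S\end{bmatrix}^\top Q^\top\\ 0&0&-\bar\Gamma-\mathbf C&-\mathbf B\\ Q\begin{bmatrix}\bar\Gamma\\ \bar Y\end{bmatrix}&Q\begin{bmatrix}0\\ \bar S\end{bmatrix}&-\mathbf B^\top&-\mathbf A\end{bmatrix}\preceq0\qquad\text{for all }Q\in\bar{\mathcal Q}.$$ Let $K=\bar Y\bar\Gamma^{-1}$ and $$\bar r_0=\min\left\{r,\ \sqrt{\frac{\lambda_{\max}(\bar\Gamma)\lambda_{\min}(\bar\Gamma)}{\lambda_{\max}^2(\bar\Gamma)-\epsilon_{\bar\Gamma}\lambda_{\min}(\bar\Gamma)}}\cdot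 r\right\}$$ (with $\bar r_0=r$ if the denominator is zero), and let $\mathcal R=\mathcal B_{\bar r_0}\cap\{x\in\mathbb R^n:x^\top\bar\Gamma^{-1}x\le1\}$. Then $\mathcal R$ is a region of attraction of the closed-loop system $x^+=A(x)x+B(x)\,\mathrm{sat}(Kx)$: the origin is an equilibrium, and every solution with $x(0)\in\mathcal R$ remains in $\mathbb X$ and satisfies $x(k)\to0$. Moreover, the convergence is exponential: there are $c>0$ and $\rho\in(0,1)$ such that $|x(k)|\le c\,\rho^k|x(0)|$ for all $k\in\mathbb N$ and every solution with $x(0)\in\mathcal R$. -/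

import Mathlib

open Matrix Filter Topology

noncomputable section

namespace SatControl

/-- Largest eigenvalue of a symmetric real matrix. -/
def lambdaMax {n : ℕ} (M : Matrix (Fin n) (Fin n) ℝ) : ℝ := sSup (spectrum ℝ M)

/-- Smallest eigenvalue of a symmetric real matrix. -/
def lambdaMin {n : ℕ} (M : Matrix (Fin n) (Fin n) ℝ) : ℝ := sInf (spectrum ℝ M)

/-- The relation `M ⪯ 0`. -/
def NegSemidef {ι : Type*} (M : Matrix ι ι ℝ) : Prop := (-M).PosSemidef

/-- Componentwise saturation with level vector `ubar`. -/
def sat {m : ℕ} (ubar : Fin m → ℝ) (u : Fin m → ℝ) : Fin m → ℝ :=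
  fun i => Real.sign (u i) * min |u i| (ubar i)

/-- The right-hand side `x ↦ A(x) x + B(x) sat(K x)` of the closed loop. -/
def closedLoop {n m : ℕ}
    (A : EuclideanSpace ℝ (Fin n) → Matrix (Fin n) (Fin n) ℝ)
    (B : EuclideanSpace ℝ (Fin n) → Matrix (Fin n) (Fin m) ℝ)
    (ubar : Fin m → ℝ) (K : Matrix (Fin m) (Fin n) ℝ) :
    EuclideanSpace ℝ (Fin n) → EuclideanSpace ℝ (Fin n) :=
  fun x => WithLp.toLp 2 (A x *ᵥ x.ofLp + B x *ᵥ sat ubar (K *ᵥ x.ofLp))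

/-- `x` is a solution of `x⁺ = f(x)`. -/
def IsTrajectory {E : Type*} (f : E → E) (x : ℕ → E) : Prop :=
  ∀ k, x (k + 1) = f (x k)

/-- `R` is a region of attraction of `x⁺ = f(x)` relative to the equilibrium `0`. -/
def IsRegionOfAttraction {E : Type*} [NormedAddCommGroup E] (f : E → E) (R : Set E) : Prop :=
  f 0 = 0 ∧ ∀ x : ℕ → E, IsTrajectory f x → x 0 ∈ R → Tendsto x atTop (𝓝 0)

/-- The solutions of `x⁺ = f(x)` starting in `R` converge exponentially to `0`. -/
def ConvergesExponentiallyFrom {E : Type*} [NormedAddCommGroup E] (f : E → E) (R : Set E) :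
    Prop :=
  ∃ c ρ : ℝ, 0 < c ∧ 0 < ρ ∧ ρ < 1 ∧
    ∀ x : ℕ → E, IsTrajectory f x → x 0 ∈ R → ∀ k, ‖x k‖ ≤ c * ρ ^ k * ‖x 0‖

/-- The ellipsoid `{x : xᵀ M x ≤ τ}`. -/
def ellipsoid {n : ℕ} (M : Matrix (Fin n) (Fin n) ℝ) (τ : ℝ) : Set (EuclideanSpace ℝ (Fin n)) :=
  {x | x.ofLp ⬝ᵥ (M *ᵥ x.ofLp) ≤ τ}

/-- The horizontal concatenation `[E_1 ⋯ E_p]`. -/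
def hcat {n p : ℕ} {N : Fin p → ℕ} (E : ∀ j, Matrix (Fin n) (Fin (N j)) ℝ) :
    Matrix (Fin n) (Σ j, Fin (N j)) ℝ :=
  Matrix.of fun i q => E q.1 i q.2

/-- `blkdiag(ζ_1, …, ζ_p)` for column vectors `ζ_j`; rows are indexed by the pairs `(j, i)`. -/
def blkCols {p : ℕ} {N : Fin p → ℕ} (ζ : ∀ j, Fin (N j) → ℝ) :
    Matrix (Σ j, Fin (N j)) (Fin p) ℝ :=
  Matrix.of fun q j => if q.1 = j then ζ q.1 q.2 else 0

/-- Maximum over the closed ball of radius `r` of the `i`-th entry of `ξ_j`. -/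
def entryMax {n p : ℕ} {N : Fin p → ℕ}
    (ξ : ∀ j : Fin p, EuclideanSpace ℝ (Fin n) → Fin (N j) → ℝ) (r : ℝ)
    (j : Fin p) (i : Fin (N j)) : ℝ :=
  sSup ((fun x => ξ j x i) '' Metric.closedBall 0 r)

/-- Minimum over the closed ball of radius `r` of the `i`-th entry of `ξ_j`. -/
def entryMin {n p : ℕ} {N : Fin p → ℕ}
    (ξ : ∀ j : Fin p, EuclideanSpace ℝ (Fin n) → Fin (N j) → ℝ) (r : ℝ)
    (j : Fin p) (i : Fin (N j)) : ℝ :=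
  sInf ((fun x => ξ j x i) '' Metric.closedBall 0 r)

/-- The finite set of matrices `blkdiag(ζ_{A_1}, …, ζ_{A_n}, ζ_{B_1}, …, ζ_{B_m})` in which each
entry of each `ζ` is the maximum or the minimum over the ball of the same entry of `ξ`. -/
def vertexSet {n m : ℕ} {nA : Fin n → ℕ} {nB : Fin m → ℕ}
    (ξA : ∀ j : Fin n, EuclideanSpace ℝ (Fin n) → Fin (nA j) → ℝ)
    (ξB : ∀ j : Fin m, EuclideanSpace ℝ (Fin n) → Fin (nB j) → ℝ) (r : ℝ) :
    Set (Matrix ((Σ j, Fin (nA j)) ⊕ (Σ j, Fin (nB j))) (Fin n ⊕ Fin m) ℝ) :=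
  {Q | ∃ (ζA : ∀ j, Fin (nA j) → ℝ) (ζB : ∀ j, Fin (nB j) → ℝ),
      (∀ j i, ζA j i = entryMax ξA r j i ∨ ζA j i = entryMin ξA r j i) ∧
      (∀ j i, ζB j i = entryMax ξB r j i ∨ ζB j i = entryMin ξB r j i) ∧
      Q = fromBlocks (blkCols ζA) 0 0 (blkCols ζB)}

/-- The matrix with columns `v 0, …, v (T-1)`. -/
def ofCols {ι : Type*} {T : ℕ} (v : Fin T → ι → ℝ) : Matrix ι (Fin T) ℝ :=
  Matrix.of fun i k => v k i

/-- `X₀ = [Ξ_A(x_d(0)) x_d(0) ⋯ Ξ_A(x_d(T-1)) x_d(T-1)]`. -/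
def dataX0 {n T : ℕ} {nA : Fin n → ℕ}
    (ξA : ∀ j : Fin n, EuclideanSpace ℝ (Fin n) → Fin (nA j) → ℝ)
    (xd : Fin (T + 1) → EuclideanSpace ℝ (Fin n)) : Matrix (Σ j, Fin (nA j)) (Fin T) ℝ :=
  ofCols fun k => blkCols (fun j => ξA j (xd k.castSucc)) *ᵥ (xd k.castSucc).ofLp

/-- `U₀ = [Ξ_B(x_d(0)) u_d(0) ⋯ Ξ_B(x_d(T-1)) u_d(T-1)]`. -/
def dataU0 {n m T : ℕ} {nB : Fin m → ℕ}
    (ξB : ∀ j : Fin m, EuclideanSpace ℝ (Fin n) → Fin (nB j) → ℝ)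
    (xd : Fin (T + 1) → EuclideanSpace ℝ (Fin n)) (ud : Fin T → Fin m → ℝ) :
    Matrix (Σ j, Fin (nB j)) (Fin T) ℝ :=
  ofCols fun k => blkCols (fun j => ξB j (xd k.castSucc)) *ᵥ ud k

/-- `X₁ = [x_d(1) ⋯ x_d(T)]`. -/
def dataX1 {n T : ℕ} (xd : Fin (T + 1) → EuclideanSpace ℝ (Fin n)) : Matrix (Fin n) (Fin T) ℝ :=
  ofCols fun k => (xd k.succ).ofLp

/-- `𝐀 = H Hᵀ`, where `H = [X₀; U₀]`. -/
def boldA {σ : Type*} {T : ℕ} (H : Matrix σ (Fin T) ℝ) : Matrix σ σ ℝ := H * Hᵀ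

/-- `𝐁 = - X₁ Hᵀ`, where `H = [X₀; U₀]`. -/
def boldB {σ : Type*} {n T : ℕ} (X₁ : Matrix (Fin n) (Fin T) ℝ) (H : Matrix σ (Fin T) ℝ) :
    Matrix (Fin n) σ ℝ := -(X₁ * Hᵀ)

/-- `𝐂 = X₁ X₁ᵀ - Θ`. -/
def boldC {n T : ℕ} (X₁ : Matrix (Fin n) (Fin T) ℝ) (Θ : Matrix (Fin n) (Fin n) ℝ) :
    Matrix (Fin n) (Fin n) ℝ := X₁ * X₁ᵀ - Θ

/-- The block matrix `[Γ, W_(i)ᵀ; W_(i), ū_i²]`, with `w = W_(i)` and `c = ū_i`. -/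
def inputBlock {n : ℕ} (Γ : Matrix (Fin n) (Fin n) ℝ) (w : Fin n → ℝ) (c : ℝ) :
    Matrix (Fin n ⊕ Unit) (Fin n ⊕ Unit) ℝ :=
  fromBlocks Γ (replicateCol Unit w) (replicateRow Unit w) (Matrix.of fun _ _ => c ^ 2)

/-- The block matrix with the four block rows
`[-Γ + ε I, -Yᵀ - Wᵀ, 0, [Γ; Y]ᵀ Qᵀ]`, `[-Y - W, -2 S, 0, [0; S]ᵀ Qᵀ]`,
`[0, 0, -Γ - 𝐂, -𝐁]`, `[Q [Γ; Y], Q [0; S], -𝐁ᵀ, -𝐀]`. -/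
def dataBlock {n m : ℕ} {σ : Type*}
    (Γ : Matrix (Fin n) (Fin n) ℝ) (ε : ℝ) (Y W : Matrix (Fin m) (Fin n) ℝ)
    (S : Matrix (Fin m) (Fin m) ℝ)
    (bA : Matrix σ σ ℝ) (bB : Matrix (Fin n) σ ℝ) (bC : Matrix (Fin n) (Fin n) ℝ)
    (Q : Matrix σ (Fin n ⊕ Fin m) ℝ) :
    Matrix ((Fin n ⊕ Fin m) ⊕ (Fin n ⊕ σ)) ((Fin n ⊕ Fin m) ⊕ (Fin n ⊕ σ)) ℝ :=
  fromBlocks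
    (fromBlocks (-Γ + ε • (1 : Matrix (Fin n) (Fin n) ℝ)) (-Yᵀ - Wᵀ) (-Y - W) (-((2 : ℝ) • S)))
    (fromBlocks 0 ((fromRows Γ Y)ᵀ * Qᵀ) 0 ((fromRows 0 S)ᵀ * Qᵀ))
    (fromBlocks 0 0 (Q * fromRows Γ Y) (Q * fromRows 0 S))
    (fromBlocks (-Γ - bC) (-bB) (-bBᵀ) (-bA))

/-- `min {r, √(λ_max(Γ) λ_min(Γ) / (λ_max(Γ)² - ε λ_min(Γ))) r}`, where a vanishing denominator
means that the square root is `+∞`, so that the minimum is `r`. -/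
def roaRadius {n : ℕ} (r : ℝ) (Γ : Matrix (Fin n) (Fin n) ℝ) (ε : ℝ) : ℝ :=
  if lambdaMax Γ ^ 2 - ε * lambdaMin Γ = 0 then r
  else min r
    (Real.sqrt (lambdaMax Γ * lambdaMin Γ / (lambdaMax Γ ^ 2 - ε * lambdaMin Γ)) * r)

end SatControl

end

open SatControl

/-! Let `V x = xᵀ Γ⁻¹ x` and `a = Γ⁻¹ x`, so that `Y a = K x`. Test the data inequality on vectors
`(a, b, c, e)` with `e = Eᵀ c`, `E = [E_A E_B]`. The noise bound lets the data terms be dropped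
(`noise_form_nonneg`), leaving an inequality for the true `E`. It is linear in `Q`, so the vertices
control every point of the ball (`dataBlock_form_nonpos_on_ball`). Taking `S b = sat (K x) - K x`
and `c = Γ⁻¹ x⁺`, the sector condition for the saturation gives `V x⁺ ≤ V x - ε |a|²`
(`lyapunov_decrease`).

This decrease holds only where `|x| ≤ r` and `V x ≤ 1`. The radius `roaRadius` ensures that the
first step satisfies `λ_max V (x 1) ≤ r²`; monotonicity of `V` then keeps the orbit in the ball of
radius `r`, with geometric decay (`exists_exponential_bound`). -/

namespace SatControl

/-! ### Quadratic forms of the matrix inequality and of the noise bound. -/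

/-- `dataBlock` with all products elaborated as products of matrices. -/
theorem dataBlock_eq {n m : ℕ} {σ : Type*}
    (Γ : Matrix (Fin n) (Fin n) ℝ) (ε : ℝ) (Y W : Matrix (Fin m) (Fin n) ℝ)
    (S : Matrix (Fin m) (Fin m) ℝ)
    (bA : Matrix σ σ ℝ) (bB : Matrix (Fin n) σ ℝ) (bC : Matrix (Fin n) (Fin n) ℝ)
    (Q : Matrix σ (Fin n ⊕ Fin m) ℝ) :
    dataBlock Γ ε Y W S bA bB bC Q = fromBlocks
      (fromBlocks (-Γ + ε • (1 : Matrix (Fin n) (Fin n) ℝ)) (-Yᵀ - Wᵀ) (-Y - W) (-((2 : ℝ) • S)))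
      (fromBlocks 0 (Q * fromRows Γ Y)ᵀ 0 (Q * fromRows (0 : Matrix (Fin n) (Fin m) ℝ) S)ᵀ)
      (fromBlocks 0 0 (Q * fromRows Γ Y) (Q * fromRows (0 : Matrix (Fin n) (Fin m) ℝ) S))
      (fromBlocks (-Γ - bC) (-bB) (-bBᵀ) (-bA)) := by
  rw [transpose_mul, transpose_mul]
  rfl

theorem dotProduct_mulVec_transpose_comm {ι κ : Type*} [Fintype ι] [Fintype κ]
    (M : Matrix ι κ ℝ) (u : κ → ℝ) (v : ι → ℝ) : u ⬝ᵥ (Mᵀ *ᵥ v) = v ⬝ᵥ (M *ᵥ u) := by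
  rw [mulVec_transpose, dotProduct_comm, ← dotProduct_mulVec]

/-- Since `[Γ; Y] a + [0; S] b = (Γ a, Y a + S b)`, the `Q`-blocks merge into one pairing, linear in
`Q`. -/
theorem dataBlock_form_nonpos {n m : ℕ} {σ : Type*} [Fintype σ]
    {Γ : Matrix (Fin n) (Fin n) ℝ} {ε : ℝ} {Y W : Matrix (Fin m) (Fin n) ℝ}
    {S : Matrix (Fin m) (Fin m) ℝ} {bA : Matrix σ σ ℝ} {bB : Matrix (Fin n) σ ℝ}
    {bC : Matrix (Fin n) (Fin n) ℝ} {Q : Matrix σ (Fin n ⊕ Fin m) ℝ}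
    (h : NegSemidef (dataBlock Γ ε Y W S bA bB bC Q))
    (a : Fin n → ℝ) (b : Fin m → ℝ) (c : Fin n → ℝ) (e : σ → ℝ) :
    ε * (a ⬝ᵥ a) - a ⬝ᵥ (Γ *ᵥ a) - 2 * (b ⬝ᵥ (Y *ᵥ a + W *ᵥ a)) - 2 * (b ⬝ᵥ (S *ᵥ b))
      - c ⬝ᵥ (Γ *ᵥ c) - (c ⬝ᵥ (bC *ᵥ c) + 2 * (c ⬝ᵥ (bB *ᵥ e)) + e ⬝ᵥ (bA *ᵥ e))
      + 2 * (e ⬝ᵥ (Q *ᵥ Sum.elim (Γ *ᵥ a) (Y *ᵥ a + S *ᵥ b))) ≤ 0 := by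
  have h0 := h.dotProduct_mulVec_nonneg (Sum.elim (Sum.elim a b) (Sum.elim c e))
  have h1 : Q *ᵥ Sum.elim (Γ *ᵥ a) (Y *ᵥ a + S *ᵥ b)
      = (Q * fromRows Γ Y) *ᵥ a + (Q * fromRows (0 : Matrix (Fin n) (Fin m) ℝ) S) *ᵥ b := by
    rw [← mulVec_mulVec, ← mulVec_mulVec, ← mulVec_add, fromRows_mulVec, fromRows_mulVec]
    congr 1
    ext (i | i) <;> simp
  rw [h1]
  simp only [dataBlock_eq, neg_mulVec, fromBlocks_mulVec, dotProduct_neg, star_trivial,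
    sumElim_dotProduct_sumElim, Sum.elim_comp_inl, Sum.elim_comp_inr, add_mulVec, sub_mulVec,
    smul_mulVec, one_mulVec, zero_mulVec, dotProduct_add, dotProduct_sub, dotProduct_smul,
    dotProduct_mulVec_transpose_comm, smul_eq_mul] at h0 ⊢
  simp at h0
  linarith

/-- Completing the square turns the left side into `|X₁ᵀ c - Hᵀ Eᵀ c|² - cᵀ Θ c = |Dᵀ c|² - cᵀ Θ c`.
-/
theorem noise_form_nonneg {σ : Type*} [Fintype σ] {n T : ℕ}
    {X₁ D : Matrix (Fin n) (Fin T) ℝ} {H : Matrix σ (Fin T) ℝ} {E : Matrix (Fin n) σ ℝ}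
    {Θ : Matrix (Fin n) (Fin n) ℝ} (hX : X₁ = E * H + D) (hD : (Θ - D * Dᵀ).PosSemidef)
    (c : Fin n → ℝ) :
    c ⬝ᵥ (boldC X₁ Θ *ᵥ c) + 2 * (c ⬝ᵥ (boldB X₁ H *ᵥ (Eᵀ *ᵥ c)))
      + (Eᵀ *ᵥ c) ⬝ᵥ (boldA H *ᵥ (Eᵀ *ᵥ c)) ≤ 0 := by
  have h0 := hD.dotProduct_mulVec_nonneg c
  have hDt : Dᵀ *ᵥ c = X₁ᵀ *ᵥ c - Hᵀ *ᵥ (Eᵀ *ᵥ c) := by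
    rw [hX, transpose_add, transpose_mul, add_mulVec, mulVec_mulVec]; simp
  have sq : ∀ M : Matrix (Fin n) (Fin T) ℝ,
      c ⬝ᵥ ((M * Mᵀ) *ᵥ c) = (Mᵀ *ᵥ c) ⬝ᵥ (Mᵀ *ᵥ c) := by
    intro M
    rw [← mulVec_mulVec, dotProduct_mulVec, ← mulVec_transpose]
  have sq1 : c ⬝ᵥ ((X₁ * Hᵀ) *ᵥ (Eᵀ *ᵥ c)) = (X₁ᵀ *ᵥ c) ⬝ᵥ (Hᵀ *ᵥ (Eᵀ *ᵥ c)) := by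
    rw [← mulVec_mulVec, dotProduct_mulVec, ← mulVec_transpose]
  have sq2 : (Eᵀ *ᵥ c) ⬝ᵥ ((H * Hᵀ) *ᵥ (Eᵀ *ᵥ c))
      = (Hᵀ *ᵥ (Eᵀ *ᵥ c)) ⬝ᵥ (Hᵀ *ᵥ (Eᵀ *ᵥ c)) := by
    rw [← mulVec_mulVec, dotProduct_mulVec, ← mulVec_transpose]
  simp only [boldA, boldB, boldC, sub_mulVec, neg_mulVec, dotProduct_sub, dotProduct_neg,
    star_trivial, sq1, sq2, sq] at h0 ⊢
  rw [hDt] at h0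
  simp only [dotProduct_sub, sub_dotProduct] at h0
  rw [dotProduct_comm (Hᵀ *ᵥ (Eᵀ *ᵥ c)) (X₁ᵀ *ᵥ c)] at h0
  linarith

/-! ### Basis functions and reduction to vertices. -/

theorem hcat_mulVec_blkCols {n p : ℕ} {N : Fin p → ℕ} (E : ∀ j, Matrix (Fin n) (Fin (N j)) ℝ)
    (ζ : ∀ j, Fin (N j) → ℝ) (M : Matrix (Fin n) (Fin p) ℝ)
    (hM : ∀ j, (fun i => M i j) = E j *ᵥ ζ j) (v : Fin p → ℝ) :
    hcat E *ᵥ (blkCols ζ *ᵥ v) = M *ᵥ v := by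
  have hb : ∀ q, (blkCols ζ *ᵥ v) q = ζ q.1 q.2 * v q.1 := by
    intro q
    simp [blkCols, mulVec, dotProduct]
  ext i
  simp only [mulVec, dotProduct, Fintype.sum_sigma] at hb ⊢
  simp only [hb, hcat, of_apply]
  refine Finset.sum_congr rfl fun j _ => ?_
  have := congrFun (hM j) i
  rw [this]
  simp [mulVec, dotProduct, Finset.sum_mul, mul_assoc]

theorem dotProduct_blkCols_mulVec {p : ℕ} {N : Fin p → ℕ} (ζ : ∀ j, Fin (N j) → ℝ)
    (e : (Σ j, Fin (N j)) → ℝ) (v : Fin p → ℝ) :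
    e ⬝ᵥ (blkCols ζ *ᵥ v) = ∑ q, (e q * v q.1) * ζ q.1 q.2 := by
  have hb : ∀ q, (blkCols ζ *ᵥ v) q = ζ q.1 q.2 * v q.1 := by
    intro q
    simp [blkCols, mulVec, dotProduct]
  simp only [dotProduct, hb]
  exact Finset.sum_congr rfl fun q _ => by ring

/-- A linear functional of a block column matrix is maximized over a box at one of its
vertices. -/
theorem exists_vertex_ge {p : ℕ} {N : Fin p → ℕ} (lo hi ζ : ∀ j, Fin (N j) → ℝ)
    (hlo : ∀ j i, lo j i ≤ ζ j i) (hhi : ∀ j i, ζ j i ≤ hi j i)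
    (e : (Σ j, Fin (N j)) → ℝ) (v : Fin p → ℝ) :
    ∃ η : ∀ j, Fin (N j) → ℝ, (∀ j i, η j i = hi j i ∨ η j i = lo j i) ∧
      e ⬝ᵥ (blkCols ζ *ᵥ v) ≤ e ⬝ᵥ (blkCols η *ᵥ v) := by
  classical
  -- The functional is a sum over the entries of `ζ` separately, so the sign of each coefficient
  -- decides between the upper and lower bound.
  refine ⟨fun j i => if 0 ≤ e ⟨j, i⟩ * v j then hi j i else lo j i, ?_, ?_⟩
  · intro j i
    by_cases h : 0 ≤ e ⟨j, i⟩ * v j <;> simp [h]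
  · rw [dotProduct_blkCols_mulVec, dotProduct_blkCols_mulVec]
    refine Finset.sum_le_sum fun q _ => ?_
    obtain ⟨j, i⟩ := q
    by_cases h : 0 ≤ e ⟨j, i⟩ * v j
    · simp only [h, if_true]
      exact mul_le_mul_of_nonneg_left (hhi j i) h
    · simp only [h, if_false]
      exact mul_le_mul_of_nonpos_left (hlo j i) (le_of_not_ge h)

theorem entryMin_le_and_le_entryMax {n p : ℕ} {N : Fin p → ℕ}
    {ξ : ∀ j : Fin p, EuclideanSpace ℝ (Fin n) → Fin (N j) → ℝ} {r : ℝ}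
    (hξ : ∀ j, ContinuousOn (ξ j) (Metric.closedBall 0 r)) {x : EuclideanSpace ℝ (Fin n)}
    (hx : x ∈ Metric.closedBall 0 r) (j : Fin p) (i : Fin (N j)) :
    entryMin ξ r j i ≤ ξ j x i ∧ ξ j x i ≤ entryMax ξ r j i := by
  have hc : IsCompact ((fun x => ξ j x i) '' Metric.closedBall 0 r) :=
    (isCompact_closedBall 0 r).image_of_continuousOn (continuousOn_pi.1 (hξ j) i)
  exact ⟨csInf_le hc.bddBelow ⟨x, hx, rfl⟩, le_csSup hc.bddAbove ⟨x, hx, rfl⟩⟩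

/-! ### The saturation and its sector condition. -/

/-- Without saturation the first factor vanishes. With saturation `sat u - u` is zero or opposite in
sign to `u`, while `|g| ≤ ubar` prevents `g` from reversing the sign of `±ubar`. -/
theorem sat_sub_mul_sat_add_nonpos {m : ℕ} {ubar : Fin m → ℝ} (hubar : ∀ i, 0 < ubar i)
    (u g : Fin m → ℝ) (i : Fin m) (hg : |g i| ≤ ubar i) :
    (sat ubar u i - u i) * (sat ubar u i + g i) ≤ 0 := by
  obtain ⟨h1, h2⟩ := abs_le.1 hg
  have h0 := hubar i
  unfold sat
  rcases le_total |u i| (ubar i) with h | h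
  · rw [min_eq_left h]
    have : Real.sign (u i) * |u i| = u i := by
      rcases lt_trichotomy (u i) 0 with h | h | h
      · simp [Real.sign_of_neg h, abs_of_neg h]
      · simp [h]
      · simp [Real.sign_of_pos h, abs_of_pos h]
    simp [this]
  · rw [min_eq_right h]
    rcases lt_trichotomy (u i) 0 with h' | h' | h'
    · rw [Real.sign_of_neg h']
      rw [abs_of_neg h'] at h
      exact mul_nonpos_of_nonneg_of_nonpos (by linarith) (by linarith)
    · rw [h', abs_zero] at h
      linarith
    · rw [Real.sign_of_pos h']
      rw [abs_of_pos h'] at h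
      exact mul_nonpos_of_nonpos_of_nonneg (by linarith) (by linarith)

theorem abs_dotProduct_le_of_inputBlock {n : ℕ} {Γ : Matrix (Fin n) (Fin n) ℝ} {w : Fin n → ℝ}
    {c : ℝ} (hc : 0 < c) (h : (inputBlock Γ w c).PosSemidef) {a : Fin n → ℝ}
    (ha : a ⬝ᵥ (Γ *ᵥ a) ≤ 1) : |w ⬝ᵥ a| ≤ c := by
  have key : ∀ t : ℝ, 0 ≤ a ⬝ᵥ (Γ *ᵥ a) + 2 * t * (w ⬝ᵥ a) + t ^ 2 * c ^ 2 := by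
    intro t
    have h0 := h.dotProduct_mulVec_nonneg (Sum.elim a fun _ => t)
    have e1 : replicateCol Unit w *ᵥ (fun _ => t) = t • w := by
      ext i; simp [mulVec, dotProduct, mul_comm]
    have e2 : replicateRow Unit w *ᵥ a = fun _ => w ⬝ᵥ a := by
      ext i; simp [mulVec, dotProduct]
    simp only [inputBlock, fromBlocks_mulVec, star_trivial, sumElim_dotProduct_sumElim,
      Sum.elim_comp_inl, Sum.elim_comp_inr, e1, e2, dotProduct_add, dotProduct_smul] at h0
    simp [mulVec, dotProduct_comm a w] at h0
    simp [dotProduct] at h0 ⊢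
    linarith
  -- At `t = ±1/c` the form is at most `2 ± (2/c) (w ⬝ᵥ a)`, which gives both halves of the bound.
  have k1 := key (1 / c)
  have k2 := key (-1 / c)
  have hcc : (1 / c) ^ 2 * c ^ 2 = 1 := by field_simp
  have hcc' : (-1 / c) ^ 2 * c ^ 2 = 1 := by field_simp
  rw [hcc] at k1
  rw [hcc'] at k2
  have hd : w ⬝ᵥ a = c * (1 / c * (w ⬝ᵥ a)) := by field_simp
  have e3 : -1 / c = -(1 / c) := by ring
  rw [e3] at k2
  rw [abs_le, hd]
  constructor <;> nlinarith

/-! ### Eigenvalue bounds. -/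

open scoped MatrixOrder in
theorem lambdaMin_mul_le_and_le_lambdaMax_mul {n : ℕ} {M : Matrix (Fin n) (Fin n) ℝ}
    (hM : M.IsHermitian) (v : Fin n → ℝ) :
    lambdaMin M * (v ⬝ᵥ v) ≤ v ⬝ᵥ (M *ᵥ v) ∧ v ⬝ᵥ (M *ᵥ v) ≤ lambdaMax M * (v ⬝ᵥ v) := by
  have hfin : (spectrum ℝ M).Finite := M.finite_real_spectrum
  have h1 : algebraMap ℝ (Matrix (Fin n) (Fin n) ℝ) (lambdaMin M) ≤ M :=
    algebraMap_le_of_le_spectrum (fun x hx => csInf_le hfin.bddBelow hx) hM.isSelfAdjoint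
  have h2 : M ≤ algebraMap ℝ (Matrix (Fin n) (Fin n) ℝ) (lambdaMax M) :=
    le_algebraMap_of_spectrum_le (fun x hx => le_csSup hfin.bddAbove hx) hM.isSelfAdjoint
  have h3 := (Matrix.le_iff.1 h1).dotProduct_mulVec_nonneg v
  have h4 := (Matrix.le_iff.1 h2).dotProduct_mulVec_nonneg v
  simp only [Algebra.algebraMap_eq_smul_one, sub_mulVec, smul_mulVec, one_mulVec, star_trivial,
    dotProduct_sub, dotProduct_smul, smul_eq_mul] at h3 h4
  exact ⟨by linarith, by linarith⟩

theorem exists_eigenvector_lambdaMin {n : ℕ} [NeZero n] {M : Matrix (Fin n) (Fin n) ℝ}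
    (hM : M.IsHermitian) : ∃ v : Fin n → ℝ, 0 < v ⬝ᵥ v ∧ M *ᵥ v = lambdaMin M • v := by
  have hne : (spectrum ℝ M).Nonempty := by
    rw [hM.spectrum_real_eq_range_eigenvalues]
    exact Set.range_nonempty _
  have hmem : lambdaMin M ∈ spectrum ℝ M := hne.csInf_mem M.finite_real_spectrum
  rw [hM.spectrum_real_eq_range_eigenvalues] at hmem
  obtain ⟨i, hi⟩ := hmem
  refine ⟨(hM.eigenvectorBasis i).ofLp, ?_, ?_⟩
  · have h1 : (hM.eigenvectorBasis i).ofLp ≠ 0 := fun h =>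
      hM.eigenvectorBasis.orthonormal.ne_zero i ((WithLp.ofLp_eq_zero 2).1 h)
    simpa using dotProduct_star_self_pos_iff.2 h1
  · rw [← hi]
    exact hM.mulVec_eigenvectorBasis i

theorem norm_sq_eq_dotProduct {n : ℕ} (x : EuclideanSpace ℝ (Fin n)) :
    ‖x‖ ^ 2 = x.ofLp ⬝ᵥ x.ofLp := by
  rw [EuclideanSpace.real_norm_sq_eq]
  simp [dotProduct, sq]

theorem PosSemidef.dotProduct_mulVec_sq_le {n : ℕ} {M : Matrix (Fin n) (Fin n) ℝ}
    (hM : M.PosSemidef) (u v : Fin n → ℝ) :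
    (u ⬝ᵥ (M *ᵥ v)) ^ 2 ≤ (u ⬝ᵥ (M *ᵥ u)) * (v ⬝ᵥ (M *ᵥ v)) := by
  have hs : v ⬝ᵥ (M *ᵥ u) = u ⬝ᵥ (M *ᵥ v) := by
    have : Mᵀ = M := hM.1
    rw [dotProduct_mulVec, ← mulVec_transpose, this, dotProduct_comm]
  have h : ∀ t : ℝ, 0 ≤ (v ⬝ᵥ (M *ᵥ v)) * (t * t) + 2 * (u ⬝ᵥ (M *ᵥ v)) * t
      + u ⬝ᵥ (M *ᵥ u) := by
    intro t
    have h0 := hM.dotProduct_mulVec_nonneg (u + t • v)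
    simp only [star_trivial, mulVec_add, mulVec_smul, dotProduct_add, add_dotProduct,
      dotProduct_smul, smul_dotProduct, smul_eq_mul, hs] at h0
    linarith
  have := discrim_le_zero h
  unfold discrim at this
  nlinarith

/-- With `M = Γ` and `a = Γ⁻¹ x` this compares `|x|²` with `V x` without the spectrum of `Γ⁻¹`. Both
bounds are Cauchy–Schwarz followed by a cancellation: in the form of `M` for the upper one, in the
Euclidean product for the lower one. -/
theorem dotProduct_mulVec_mulVec_self_bounds {n : ℕ} {M : Matrix (Fin n) (Fin n) ℝ}
    (hM : M.PosSemidef) {μ L : ℝ} (hμ : 0 < μ) (hL : 0 < L)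
    (hlo : ∀ v, μ * (v ⬝ᵥ v) ≤ v ⬝ᵥ (M *ᵥ v)) (hhi : ∀ v, v ⬝ᵥ (M *ᵥ v) ≤ L * (v ⬝ᵥ v))
    (a : Fin n → ℝ) :
    (M *ᵥ a) ⬝ᵥ (M *ᵥ a) ≤ L * (a ⬝ᵥ (M *ᵥ a)) ∧
      μ * (a ⬝ᵥ (M *ᵥ a)) ≤ (M *ᵥ a) ⬝ᵥ (M *ᵥ a) := by
  have nn : ∀ v : Fin n → ℝ, 0 ≤ v ⬝ᵥ v := fun v =>
    Finset.sum_nonneg fun i _ => mul_self_nonneg (v i)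
  have hV : 0 ≤ a ⬝ᵥ (M *ᵥ a) := by simpa using hM.dotProduct_mulVec_nonneg a
  constructor
  · have h1 := PosSemidef.dotProduct_mulVec_sq_le hM (M *ᵥ a) a
    have h2 := hhi (M *ᵥ a)
    rcases (nn (M *ᵥ a)).eq_or_lt with h | h
    · rw [← h]; positivity
    · refine le_of_mul_le_mul_left ?_ h
      nlinarith [mul_le_mul_of_nonneg_right h2 hV]
  · have h1 := PosSemidef.dotProduct_mulVec_sq_le PosSemidef.one a (M *ᵥ a)
    simp only [one_mulVec] at h1
    have h2 := hlo a
    rcases hV.eq_or_lt with h | h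
    · rw [← h, mul_zero]; exact nn _
    · refine le_of_mul_le_mul_left ?_ h
      nlinarith [mul_le_mul_of_nonneg_right h2 (nn (M *ᵥ a))]

/-! ### Lyapunov decrease, exponential decay and the admissible radius. -/

/-- One step of the saturated closed loop decreases `x ↦ xᵀ Γ⁻¹ x`; here `a = Γ⁻¹ x`. -/
theorem lyapunov_decrease {n m : ℕ} {Γ : Matrix (Fin n) (Fin n) ℝ} (hΓ : Γ.PosDef) {ε : ℝ}
    {Y W : Matrix (Fin m) (Fin n) ℝ} {S : Matrix (Fin m) (Fin m) ℝ}
    (hSdiag : S.IsDiag) (hS : S.PosDef) {ubar : Fin m → ℝ} (hubar : ∀ i, 0 < ubar i)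
    (hin : ∀ i, (inputBlock Γ (W i) (ubar i)).PosSemidef)
    {A : Matrix (Fin n) (Fin n) ℝ} {B : Matrix (Fin n) (Fin m) ℝ}
    (hform : ∀ (a : Fin n → ℝ) (b : Fin m → ℝ) (c : Fin n → ℝ),
      ε * (a ⬝ᵥ a) - a ⬝ᵥ (Γ *ᵥ a) - 2 * (b ⬝ᵥ (Y *ᵥ a + W *ᵥ a)) - 2 * (b ⬝ᵥ (S *ᵥ b))
        - c ⬝ᵥ (Γ *ᵥ c) + 2 * (c ⬝ᵥ (A *ᵥ (Γ *ᵥ a) + B *ᵥ (Y *ᵥ a + S *ᵥ b))) ≤ 0)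
    {a : Fin n → ℝ} (ha : a ⬝ᵥ (Γ *ᵥ a) ≤ 1) {y : Fin n → ℝ}
    (hy : y = A *ᵥ (Γ *ᵥ a) + B *ᵥ sat ubar (Y *ᵥ a)) :
    y ⬝ᵥ (Γ⁻¹ *ᵥ y) ≤ a ⬝ᵥ (Γ *ᵥ a) - ε * (a ⬝ᵥ a) := by
  set u := Y *ᵥ a with hu
  let b : Fin m → ℝ := fun i => (sat ubar u i - u i) / S i i
  have hSb : S *ᵥ b = sat ubar u - u := by
    ext i
    have hSi : S i i ≠ 0 := hS.diag_pos.ne'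
    rw [← hSdiag.diagonal_diag, mulVec_diagonal]
    simp only [diag_apply, b, Pi.sub_apply]
    field_simp
  have h1 : b ⬝ᵥ (u + W *ᵥ a) + b ⬝ᵥ (S *ᵥ b) ≤ 0 := by
    rw [hSb, ← dotProduct_add]
    refine Finset.sum_nonpos fun i _ => ?_
    have hSi : 0 < S i i := hS.diag_pos
    have hg : |(W *ᵥ a) i| ≤ ubar i := abs_dotProduct_le_of_inputBlock (hubar i) (hin i) ha
    have h2 := sat_sub_mul_sat_add_nonpos hubar u (W *ᵥ a) i hg
    have h3 : b i * (u + W *ᵥ a + (sat ubar u - u)) i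
        = (sat ubar u i - u i) * (sat ubar u i + (W *ᵥ a) i) / S i i := by
      simp only [b, Pi.add_apply, Pi.sub_apply]
      ring
    rw [h3]
    exact div_nonpos_of_nonpos_of_nonneg h2 hSi.le
  have hdet : IsUnit Γ.det := (isUnit_iff_isUnit_det _).1 hΓ.isUnit
  -- This `c` maximizes `-cᵀ Γ c + 2 cᵀ y`, with value `yᵀ Γ⁻¹ y`; it plays the role of a Schur
  -- complement.
  have h4 := hform a b (Γ⁻¹ *ᵥ y)
  rw [hSb, ← hu, add_sub_cancel, ← hy, mulVec_mulVec, mul_nonsing_inv _ hdet, one_mulVec,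
    dotProduct_comm (Γ⁻¹ *ᵥ y) y, ← hSb] at h4
  linarith

/-- Exponential decay from a quadratic Lyapunov function that decreases on a ball intersected with
a sublevel set; the ball is invariant if the first step stays in it. -/
theorem exists_exponential_bound {E : Type*} [NormedAddCommGroup E] {f : E → E} {V : E → ℝ}
    {r δ μ L : ℝ} (hr : 0 ≤ r) (hδ : 0 < δ) (hμ : 0 < μ) (hL : 0 < L)
    (hlo : ∀ x, ‖x‖ ^ 2 ≤ L * V x) (hhi : ∀ x, μ * V x ≤ ‖x‖ ^ 2)
    (hdec : ∀ x, ‖x‖ ≤ r → V x ≤ 1 → V (f x) ≤ V x - δ * ‖x‖ ^ 2) :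
    ∃ c ρ : ℝ, 0 < c ∧ 0 < ρ ∧ ρ < 1 ∧ ∀ x : ℕ → E, IsTrajectory f x → ‖x 0‖ ≤ r → V (x 0) ≤ 1 →
      (L / μ - L * δ) * ‖x 0‖ ^ 2 ≤ r ^ 2 → ∀ k, ‖x k‖ ≤ r ∧ ‖x k‖ ≤ c * ρ ^ k * ‖x 0‖ := by
  have hV : ∀ x, 0 ≤ V x := fun x =>
    nonneg_of_mul_nonneg_right ((sq_nonneg _).trans (hlo x)) hL
  -- `V` contracts by `1 - δ μ`, which need not be positive; the maximum with `1 / 2` keeps the rate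
  -- in `(0, 1)`.
  set q : ℝ := max (1 - δ * μ) (1 / 2) with hq
  have hq0 : 0 < q := lt_of_lt_of_le (by norm_num) (le_max_right _ _)
  have hq1 : q < 1 := max_lt (by nlinarith [mul_pos hδ hμ]) (by norm_num)
  refine ⟨√(L / μ), √q, Real.sqrt_pos.2 (div_pos hL hμ), Real.sqrt_pos.2 hq0, ?_, ?_⟩
  · rw [Real.sqrt_lt' one_pos]; simpa using hq1
  intro x hx h0 hV0 hstep
  have hVx : ∀ y, V y ≤ ‖y‖ ^ 2 / μ := fun y => by
    rw [le_div_iff₀ hμ]; linarith [hhi y]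
  -- The third clause looks one step ahead: it puts the next point in the ball before the decrease
  -- is available there. Only the base case needs the condition on `x 0`.
  have inv : ∀ k, ‖x k‖ ≤ r ∧ V (x k) ≤ 1 ∧ L * V (x (k + 1)) ≤ r ^ 2 := by
    intro k
    induction k with
    | zero =>
      refine ⟨h0, hV0, le_trans ?_ hstep⟩
      have h1 := hdec _ h0 hV0
      rw [hx 0]
      have h2 := mul_le_mul_of_nonneg_left (h1.trans (sub_le_sub_right (hVx (x 0)) _)) hL.le
      refine h2.trans_eq ?_
      ring
    | succ k ih =>
      obtain ⟨h1, h2, h3⟩ := ih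
      have h4 : ‖x (k + 1)‖ ≤ r := abs_le_of_sq_le_sq' ((hlo _).trans h3) hr |>.2
      have h5 : V (x (k + 1)) ≤ 1 := by
        rw [hx k]
        nlinarith [hdec _ h1 h2, mul_nonneg hδ.le (sq_nonneg ‖x k‖)]
      refine ⟨h4, h5, le_trans (mul_le_mul_of_nonneg_left ?_ hL.le) h3⟩
      rw [hx (k + 1)]
      nlinarith [hdec _ h4 h5, mul_nonneg hδ.le (sq_nonneg ‖x (k + 1)‖)]
  have hgeo : ∀ k, V (x k) ≤ q ^ k * V (x 0) := by
    intro k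
    induction k with
    | zero => simp
    | succ k ih =>
      have h1 := hdec _ (inv k).1 (inv k).2.1
      rw [← hx k] at h1
      calc V (x (k + 1)) ≤ (1 - δ * μ) * V (x k) := by
            nlinarith [mul_le_mul_of_nonneg_left (hhi (x k)) hδ.le]
        _ ≤ q * V (x k) := mul_le_mul_of_nonneg_right (le_max_left _ _) (hV _)
        _ ≤ q * (q ^ k * V (x 0)) := mul_le_mul_of_nonneg_left ih hq0.le
        _ = q ^ (k + 1) * V (x 0) := by ring
  intro k
  refine ⟨(inv k).1, ?_⟩
  refine abs_le_of_sq_le_sq' ?_ (by positivity) |>.2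
  have hs : (√q ^ k) ^ 2 = q ^ k := by
    rw [← pow_mul, mul_comm, pow_mul, Real.sq_sqrt hq0.le]
  rw [mul_pow, mul_pow, hs, Real.sq_sqrt (div_pos hL hμ).le]
  calc ‖x k‖ ^ 2 ≤ L * V (x k) := hlo _
    _ ≤ L * (q ^ k * (‖x 0‖ ^ 2 / μ)) :=
        mul_le_mul_of_nonneg_left ((hgeo k).trans
          (mul_le_mul_of_nonneg_left (hVx _) (pow_pos hq0 k).le)) hL.le
    _ = L / μ * q ^ k * ‖x 0‖ ^ 2 := by ring

/-- The ball of radius `roaRadius` is small enough for the first step of the closed loop. -/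
theorem roaRadius_step {n : ℕ} {r ε : ℝ} {Γ : Matrix (Fin n) (Fin n) ℝ} (hr : 0 < r)
    (hμ : 0 < lambdaMin Γ) (hμL : lambdaMin Γ ≤ lambdaMax Γ) (hε : ε ≤ lambdaMin Γ) {t : ℝ}
    (ht0 : 0 ≤ t) (ht : t ≤ roaRadius r Γ ε) :
    t ≤ r ∧ (lambdaMax Γ / lambdaMin Γ - lambdaMax Γ * (ε / lambdaMax Γ ^ 2)) * t ^ 2 ≤ r ^ 2 := by
  unfold roaRadius at ht
  set μ := lambdaMin Γ
  set L := lambdaMax Γ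
  have hL : 0 < L := hμ.trans_le hμL
  have hκ : L / μ - L * (ε / L ^ 2) = (L ^ 2 - ε * μ) / (L * μ) := by
    field_simp
  rw [hκ]
  split_ifs at ht with h
  · exact ⟨ht, by rw [h, zero_div, zero_mul]; positivity⟩
  -- A negative denominator is excluded by `ε μ ≤ μ² ≤ L²`.
  · have hden : 0 < L ^ 2 - ε * μ := lt_of_le_of_ne (by nlinarith) (Ne.symm h)
    obtain ⟨h1, h2⟩ := le_min_iff.1 ht
    refine ⟨h1, ?_⟩
    have h3 : t ^ 2 ≤ L * μ / (L ^ 2 - ε * μ) * r ^ 2 := by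
      have := pow_le_pow_left₀ ht0 h2 2
      rwa [mul_pow, Real.sq_sqrt (by positivity)] at this
    refine (mul_le_mul_of_nonneg_left h3 (by positivity)).trans_eq ?_
    field_simp

/-! ### From the vertices to the unknown system on the ball. -/

/-- The data-based matrix inequality at the vertices bounds the quadratic form of the unknown
system at every point of the ball. -/
theorem dataBlock_form_nonpos_on_ball {n m T : ℕ} {nA : Fin n → ℕ} {nB : Fin m → ℕ}
    {ξA : ∀ j : Fin n, EuclideanSpace ℝ (Fin n) → Fin (nA j) → ℝ}
    {ξB : ∀ j : Fin m, EuclideanSpace ℝ (Fin n) → Fin (nB j) → ℝ} {r : ℝ}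
    (hξA : ∀ j, ContinuousOn (ξA j) (Metric.closedBall 0 r))
    (hξB : ∀ j, ContinuousOn (ξB j) (Metric.closedBall 0 r))
    (EA : ∀ j, Matrix (Fin n) (Fin (nA j)) ℝ) (EB : ∀ j, Matrix (Fin n) (Fin (nB j)) ℝ)
    {xd : Fin (T + 1) → EuclideanSpace ℝ (Fin n)} {ud : Fin T → Fin m → ℝ}
    {d : Fin T → Fin n → ℝ}
    (hdata : ∀ k : Fin T, (xd k.succ).ofLp =
      hcat EA *ᵥ (blkCols (fun j => ξA j (xd k.castSucc)) *ᵥ (xd k.castSucc).ofLp)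
        + hcat EB *ᵥ (blkCols (fun j => ξB j (xd k.castSucc)) *ᵥ ud k) + d k)
    {Θ : Matrix (Fin n) (Fin n) ℝ} (hd : (Θ - ofCols d * (ofCols d)ᵀ).PosSemidef)
    {Γ : Matrix (Fin n) (Fin n) ℝ} {ε : ℝ} {Y W : Matrix (Fin m) (Fin n) ℝ}
    {S : Matrix (Fin m) (Fin m) ℝ}
    (hLMI : ∀ Q ∈ vertexSet ξA ξB r,
      NegSemidef (dataBlock Γ ε Y W S
        (boldA (fromRows (dataX0 ξA xd) (dataU0 ξB xd ud)))
        (boldB (dataX1 xd) (fromRows (dataX0 ξA xd) (dataU0 ξB xd ud)))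
        (boldC (dataX1 xd) Θ) Q))
    (x : EuclideanSpace ℝ (Fin n)) (hx : x ∈ Metric.closedBall 0 r)
    (a : Fin n → ℝ) (b : Fin m → ℝ) (c : Fin n → ℝ) :
    ε * (a ⬝ᵥ a) - a ⬝ᵥ (Γ *ᵥ a) - 2 * (b ⬝ᵥ (Y *ᵥ a + W *ᵥ a)) - 2 * (b ⬝ᵥ (S *ᵥ b))
      - c ⬝ᵥ (Γ *ᵥ c)
      + 2 * (c ⬝ᵥ (hcat EA *ᵥ (blkCols (fun j => ξA j x) *ᵥ (Γ *ᵥ a))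
        + hcat EB *ᵥ (blkCols (fun j => ξB j x) *ᵥ (Y *ᵥ a + S *ᵥ b)))) ≤ 0 := by
  have hX : dataX1 xd = fromCols (hcat EA) (hcat EB)
      * fromRows (dataX0 ξA xd) (dataU0 ξB xd ud) + ofCols d := by
    rw [fromCols_mul_fromRows]
    ext i k
    exact congrFun (hdata k) i
  have hnoise := noise_form_nonneg hX hd c
  -- The vertex may depend on `a`, `b`, `c`: the inequality is needed for one test vector at a time.
  obtain ⟨ζA, hζA, hA⟩ := exists_vertex_ge (entryMin ξA r) (entryMax ξA r) (fun j => ξA j x)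
    (fun j i => (entryMin_le_and_le_entryMax hξA hx j i).1)
    (fun j i => (entryMin_le_and_le_entryMax hξA hx j i).2) ((hcat EA)ᵀ *ᵥ c) (Γ *ᵥ a)
  obtain ⟨ζB, hζB, hB⟩ := exists_vertex_ge (entryMin ξB r) (entryMax ξB r) (fun j => ξB j x)
    (fun j i => (entryMin_le_and_le_entryMax hξB hx j i).1)
    (fun j i => (entryMin_le_and_le_entryMax hξB hx j i).2) ((hcat EB)ᵀ *ᵥ c)
    (Y *ᵥ a + S *ᵥ b)
  have hvert := dataBlock_form_nonpos (hLMI _ ⟨ζA, ζB, hζA, hζB, rfl⟩) a b c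
    ((fromCols (hcat EA) (hcat EB))ᵀ *ᵥ c)
  have hsplit : ((fromCols (hcat EA) (hcat EB))ᵀ *ᵥ c)
      ⬝ᵥ (fromBlocks (blkCols ζA) 0 0 (blkCols ζB) *ᵥ Sum.elim (Γ *ᵥ a) (Y *ᵥ a + S *ᵥ b))
      = ((hcat EA)ᵀ *ᵥ c) ⬝ᵥ (blkCols ζA *ᵥ (Γ *ᵥ a))
        + ((hcat EB)ᵀ *ᵥ c) ⬝ᵥ (blkCols ζB *ᵥ (Y *ᵥ a + S *ᵥ b)) := by
    rw [transpose_fromCols, fromRows_mulVec, fromBlocks_mulVec, sumElim_dotProduct_sumElim]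
    simp only [Sum.elim_comp_inl, Sum.elim_comp_inr, zero_mulVec, add_zero, zero_add]
  rw [hsplit] at hvert
  rw [mulVec_transpose, ← dotProduct_mulVec, ← mulVec_transpose] at hA hB
  rw [dotProduct_add c]
  linarith

end SatControl

/-! ### Assembly of the theorem. -/

theorem mainTheorem6
    {n m T : ℕ} {nA : Fin n → ℕ} {nB : Fin m → ℕ}
    -- the system and its domain
    (X : Set (EuclideanSpace ℝ (Fin n)))
    (A : EuclideanSpace ℝ (Fin n) → Matrix (Fin n) (Fin n) ℝ)
    (B : EuclideanSpace ℝ (Fin n) → Matrix (Fin n) (Fin m) ℝ)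
    (ubar : Fin m → ℝ) (hubar : ∀ i, 0 < ubar i)
    -- known basis functions, unknown coefficients
    (ξA : ∀ j : Fin n, EuclideanSpace ℝ (Fin n) → Fin (nA j) → ℝ)
    (ξB : ∀ j : Fin m, EuclideanSpace ℝ (Fin n) → Fin (nB j) → ℝ)
    (hξA : ∀ j, ContinuousOn (ξA j) X) (hξB : ∀ j, ContinuousOn (ξB j) X)
    (EA : ∀ j, Matrix (Fin n) (Fin (nA j)) ℝ) (EB : ∀ j, Matrix (Fin n) (Fin (nB j)) ℝ)
    (hA : ∀ x ∈ X, ∀ j, (fun i => A x i j) = EA j *ᵥ ξA j x)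
    (hB : ∀ x ∈ X, ∀ j, (fun i => B x i j) = EB j *ᵥ ξB j x)
    -- the experiment with process noise `d`
    (xd : Fin (T + 1) → EuclideanSpace ℝ (Fin n)) (ud : Fin T → Fin m → ℝ)
    (d : Fin T → Fin n → ℝ)
    (hdata : ∀ k : Fin T, (xd k.succ).ofLp =
      hcat EA *ᵥ (blkCols (fun j => ξA j (xd k.castSucc)) *ᵥ (xd k.castSucc).ofLp)
        + hcat EB *ᵥ (blkCols (fun j => ξB j (xd k.castSucc)) *ᵥ ud k) + d k)
    -- energy bound of the noise
    (Θ : Matrix (Fin n) (Fin n) ℝ) (hΘ : Θ.PosSemidef)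
    (hd : (Θ - ofCols d * (ofCols d)ᵀ).PosSemidef)
    -- full row rank of the data
    (hrank : (fromRows (dataX0 ξA xd) (dataU0 ξB xd ud)).rank
      = Fintype.card ((Σ j, Fin (nA j)) ⊕ (Σ j, Fin (nB j))))
    -- the ball and the solution of the matrix inequalities
    (r : ℝ) (hr : 0 < r) (hrX : Metric.closedBall 0 r ⊆ X)
    (Γ : Matrix (Fin n) (Fin n) ℝ) (hΓ : Γ.PosDef) (ε : ℝ) (hε : 0 < ε)
    (Y W : Matrix (Fin m) (Fin n) ℝ)
    (S : Matrix (Fin m) (Fin m) ℝ) (hSdiag : S.IsDiag) (hS : S.PosDef)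
    (hLMI1 : ∀ i, (inputBlock Γ (W i) (ubar i)).PosSemidef)
    (hLMI2 : ∀ Q ∈ vertexSet ξA ξB r,
      NegSemidef (dataBlock Γ ε Y W S
        (boldA (fromRows (dataX0 ξA xd) (dataU0 ξB xd ud)))
        (boldB (dataX1 xd) (fromRows (dataX0 ξA xd) (dataU0 ξB xd ud)))
        (boldC (dataX1 xd) Θ) Q)) :
    IsRegionOfAttraction (closedLoop A B ubar (Y * Γ⁻¹))
        (Metric.closedBall 0 (roaRadius r Γ ε) ∩ ellipsoid Γ⁻¹ 1) ∧
      ConvergesExponentiallyFrom (closedLoop A B ubar (Y * Γ⁻¹))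
        (Metric.closedBall 0 (roaRadius r Γ ε) ∩ ellipsoid Γ⁻¹ 1) ∧
      -- the solutions do not leave the domain of the system
      ∀ x : ℕ → EuclideanSpace ℝ (Fin n),
        IsTrajectory (closedLoop A B ubar (Y * Γ⁻¹)) x →
        x 0 ∈ Metric.closedBall 0 (roaRadius r Γ ε) ∩ ellipsoid Γ⁻¹ 1 →
        ∀ k, x k ∈ X := by
  have hHA : ∀ j, ContinuousOn (ξA j) (Metric.closedBall 0 r) := fun j => (hξA j).mono hrX
  have hHB : ∀ j, ContinuousOn (ξB j) (Metric.closedBall 0 r) := fun j => (hξB j).mono hrX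
  -- In dimension zero the spectrum is empty and no eigenvector exists, but the state space is a
  -- single point.
  rcases Nat.eq_zero_or_pos n with rfl | hn
  · refine ⟨⟨Subsingleton.elim _ _, fun x _ _ => ?_⟩, ⟨1, 1 / 2, by norm_num, by norm_num,
      by norm_num, fun x _ _ k => ?_⟩, fun x _ _ k => hrX ?_⟩
    · rw [Subsingleton.elim x fun _ => 0]
      exact tendsto_const_nhds
    · rw [Subsingleton.elim (x k) 0, norm_zero]
      positivity
    · rw [Subsingleton.elim (x k) 0]
      exact Metric.mem_closedBall_self hr.le
  have : NeZero n := ⟨hn.ne'⟩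
  have hdet : IsUnit Γ.det := (isUnit_iff_isUnit_det _).1 hΓ.isUnit
  have hΓx : ∀ x : Fin n → ℝ, Γ *ᵥ (Γ⁻¹ *ᵥ x) = x := fun x => by
    rw [mulVec_mulVec, mul_nonsing_inv _ hdet, one_mulVec]
  have hform := dataBlock_form_nonpos_on_ball hHA hHB EA EB hdata hd hLMI2
  obtain ⟨v, hv0, hv⟩ := exists_eigenvector_lambdaMin hΓ.1
  have hbd := lambdaMin_mul_le_and_le_lambdaMax_mul hΓ.1
  have hvne : v ≠ 0 := fun h => by simp [h] at hv0
  have hμ : 0 < lambdaMin Γ := by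
    have h1 := hΓ.dotProduct_mulVec_pos hvne
    rw [star_trivial, hv, dotProduct_smul, smul_eq_mul] at h1
    exact pos_of_mul_pos_left h1 hv0.le
  have hμL : lambdaMin Γ ≤ lambdaMax Γ :=
    le_of_mul_le_mul_right ((hbd v).1.trans (hbd v).2) hv0
  have hL : 0 < lambdaMax Γ := hμ.trans_le hμL
  have hεμ : ε ≤ lambdaMin Γ := by
    -- With `b = c = 0` only `ε |v|² ≤ vᵀ Γ v` remains, and `v` is an eigenvector for `λ_min`.
    have h1 := hform 0 (Metric.mem_closedBall_self hr.le) v 0 0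
    simp only [zero_dotProduct, hv, dotProduct_smul, smul_eq_mul] at h1
    exact le_of_mul_le_mul_right (by linarith) hv0
  have hquad := dotProduct_mulVec_mulVec_self_bounds hΓ.posSemidef hμ hL
    (fun v => (hbd v).1) (fun v => (hbd v).2)
  obtain ⟨c, ρ, hc, hρ0, hρ1, hexp⟩ := exists_exponential_bound
    (f := closedLoop A B ubar (Y * Γ⁻¹)) (V := fun x => x.ofLp ⬝ᵥ (Γ⁻¹ *ᵥ x.ofLp))
    -- This `δ` comes from `|x|² = |Γ a|² ≤ λ_max aᵀ Γ a ≤ λ_max² |a|²`, which turns the decrease `ε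
    -- |a|²` into one in `|x|²`.
    (r := r) (δ := ε / lambdaMax Γ ^ 2) hr.le (by positivity) hμ hL
    (fun x => by
      have h1 := (hquad (Γ⁻¹ *ᵥ x.ofLp)).1
      rwa [hΓx, ← norm_sq_eq_dotProduct, dotProduct_comm (Γ⁻¹ *ᵥ x.ofLp)] at h1)
    (fun x => by
      have h1 := (hquad (Γ⁻¹ *ᵥ x.ofLp)).2
      rwa [hΓx, ← norm_sq_eq_dotProduct, dotProduct_comm (Γ⁻¹ *ᵥ x.ofLp)] at h1)
    (fun x hxr hx1 => by
      have hxb : x ∈ Metric.closedBall 0 r := mem_closedBall_zero_iff.2 hxr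
      have hVa : (Γ⁻¹ *ᵥ x.ofLp) ⬝ᵥ (Γ *ᵥ (Γ⁻¹ *ᵥ x.ofLp)) = x.ofLp ⬝ᵥ (Γ⁻¹ *ᵥ x.ofLp) := by
        rw [hΓx, dotProduct_comm]
      have hstep := lyapunov_decrease hΓ hSdiag hS hubar hLMI1 (A := A x) (B := B x)
        (fun a b c => by
          have h1 := hform x hxb a b c
          rwa [hcat_mulVec_blkCols EA _ _ (hA x (hrX hxb)),
            hcat_mulVec_blkCols EB _ _ (hB x (hrX hxb))] at h1)
        (a := Γ⁻¹ *ᵥ x.ofLp) (hVa.trans_le hx1)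
        (y := (closedLoop A B ubar (Y * Γ⁻¹) x).ofLp)
        (by rw [hΓx, mulVec_mulVec]; rfl)
      rw [hVa] at hstep
      refine hstep.trans (sub_le_sub_left ?_ _)
      have h2 := (hquad (Γ⁻¹ *ᵥ x.ofLp)).1.trans
        (mul_le_mul_of_nonneg_left (hbd (Γ⁻¹ *ᵥ x.ofLp)).2 hL.le)
      rw [hΓx, ← norm_sq_eq_dotProduct] at h2
      rw [div_mul_eq_mul_div, div_le_iff₀ (by positivity)]
      nlinarith [mul_le_mul_of_nonneg_left h2 hε.le])
  have hall : ∀ x : ℕ → EuclideanSpace ℝ (Fin n),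
      IsTrajectory (closedLoop A B ubar (Y * Γ⁻¹)) x →
      x 0 ∈ Metric.closedBall 0 (roaRadius r Γ ε) ∩ ellipsoid Γ⁻¹ 1 →
      ∀ k, ‖x k‖ ≤ r ∧ ‖x k‖ ≤ c * ρ ^ k * ‖x 0‖ := fun x hx hx0 => by
    obtain ⟨h1, h2⟩ := roaRadius_step hr hμ hμL hεμ (norm_nonneg (x 0))
      (mem_closedBall_zero_iff.1 hx0.1)
    exact hexp x hx h1 hx0.2 h2
  refine ⟨⟨?_, fun x hx hx0 => ?_⟩, ⟨c, ρ, hc, hρ0, hρ1, fun x hx hx0 k => (hall x hx hx0 k).2⟩,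
    fun x hx hx0 k => hrX (mem_closedBall_zero_iff.2 (hall x hx hx0 k).1)⟩
  · have hsat : sat ubar (0 : Fin m → ℝ) = 0 := by
      ext i
      simp [sat]
    simp [closedLoop, hsat]
  · refine squeeze_zero_norm (fun k => (hall x hx hx0 k).2) ?_
    simpa using ((tendsto_pow_atTop_nhds_zero_of_lt_one hρ0.le hρ1).const_mul c).mul_const ‖x 0‖
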